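/- Let $m\ge 1$, $[m]=\{1,\dots,m\}$, let $\mathbf k$ be a field, and let $f:2^{[m]}\to\mathbb Z/2$ be a function whose support $K_f=f^{-1}(1)$ is an abstract simplicial complex on $[m]$, i.e. $K_f$ is closed under taking subsets and $\bigcup_{a\in K_f}a=[m]$. Let $\mathbf k(K_f)=\mathbf k[v_1,\dots,v_m]/\langle \prod_{i\in\tau}v_i : \tau\subseteq[m],\ \tau\notin K_f\rangle$ be the Stanley–Reisner face ring with its $\mathbb N^m$-grading. Then $\mathbf k(K_f)$ has an $\mathbb N^m$-graded minimal free resolution of finite length over $\mathbf k[\mathbf v]=\mathbf k[v_1,\dots,v_m]$. Let $$0\leftarrow \mathbf k(K_f)\leftarrow F_0\leftarrow F_1\leftarrow\cdots\leftarrow F_h\leftarrow 0,\qquad F_i=\bigoplus_{\mathbf a\in\mathbb N^m}\mathbf k[\mathbf v](-\mathbf a)^{\beta_{i,\mathbf a}},\quad F_h\neq 0,$$ be any such resolution, where $\mathbf k[\mathbf v](-\mathbf a)$ is the free module of rank one generated in degree $\mathbf a$, all maps preserve degrees, and minimal means that each map $F_{i+1}\to F_i$ has image in $\langle v_1,\dots,v_m\rangle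 F_i$. For $a\subseteq[m]$ write $\beta_{i,a}^{\mathbf k(K_f)}=\beta_{i,\mathbf a}$, where $\mathbf a\in\{0,1\}^m$ is the indicator vector of $a$ (the Betti numbers of $\mathbf k(K_f)$). Then the Möbius transform $\mathcal M(f)(a)=\sum_{b\subseteq a}f(b)$ satisfies, as a $\mathbb Z/2$-valued function on $2^{[m]}$, $$\mathcal M(f)=\sum_{i=0}^{h}\sum_{a\in 2^{[m]}}\beta_{i,a}^{\mathbf k(K_f)}\,\delta_a ,$$ where $\delta_a(b)=1$ if $b=a$ and $\delta_a(b)=0$ otherwise. Equivalently, $\mathcal M(f)(a)\equiv\sum_{i=0}^h\beta_{i,a}^{\mathbf k(K_f)} \pmod 2$ for every $a\subseteq[m]$. -/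

import Mathlib

open MvPolynomial

noncomputable section

/-! ### Functions on the power set of `[m]` and the Möbius transform

The set `[m]` is modelled by `Fin m`, and `2^[m]` by `Finset (Fin m)`. -/

/-- The support `f⁻¹(1)` of a `ℤ/2`-valued function on `2^[m]`. -/
def suppComplex {m : ℕ} (f : Finset (Fin m) → ZMod 2) : Set (Finset (Fin m)) :=
  {a | f a = 1}

/-- `K` is an abstract simplicial complex on the vertex set `[m]`: a family of subsets of `[m]`,
closed under passing to subsets (including the empty one), whose union is all of `[m]`. -/
structure IsSimplicialComplexOn {m : ℕ} (K : Set (Finset (Fin m))) : Prop where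
  down_closed : ∀ a ∈ K, ∀ b ⊆ a, b ∈ K
  vertex_set : ∀ i : Fin m, ∃ a ∈ K, i ∈ a

/-- The `ℤ/2`-valued Möbius transform `M(f)(a) = ∑_{b ⊆ a} f(b)`. -/
def moebiusTransform {m : ℕ} (f : Finset (Fin m) → ZMod 2) : Finset (Fin m) → ZMod 2 :=
  fun a => ∑ b ∈ a.powerset, f b

/-- The function `δ_a` with value `1` at `a` and `0` elsewhere. -/
def deltaFun {m : ℕ} (a : Finset (Fin m)) : Finset (Fin m) → ZMod 2 :=
  fun b => if b = a then 1 else 0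

/-! ### The Stanley–Reisner face ring and its `ℕ^m`-grading -/

/-- The `0/1` vector in `ℕ^m` of a subset of `[m]`. -/
def squarefreeVec {m : ℕ} (a : Finset (Fin m)) : Fin m →₀ ℕ :=
  ∑ i ∈ a, Finsupp.single i 1

/-- The Stanley–Reisner ideal, generated by the monomials `∏_{i ∈ τ} v_i` with `τ ∉ K`. -/
def stanleyReisnerIdeal (k : Type*) [Field k] {m : ℕ} (K : Set (Finset (Fin m))) :
    Ideal (MvPolynomial (Fin m) k) :=
  Ideal.span {p | ∃ τ : Finset (Fin m), τ ∉ K ∧ p = ∏ i ∈ τ, X i}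

/-- The Stanley–Reisner face ring `k(K) = k[v] / I_K`. -/
abbrev FaceRing (k : Type*) [Field k] {m : ℕ} (K : Set (Finset (Fin m))) : Type _ :=
  MvPolynomial (Fin m) k ⧸ stanleyReisnerIdeal k K

/-- The degree `b` component of `k[v](-a)`, the free module of rank one generated in degree `a`:
it is spanned by the monomial `v^c` with `a + c = b` if there is one, and is zero otherwise. -/
def shiftedPiece (k : Type*) [Field k] {m : ℕ} (a b : Fin m →₀ ℕ) :
    Submodule k (MvPolynomial (Fin m) k) :=
  Submodule.span k {p | ∃ c : Fin m →₀ ℕ, a + c = b ∧ p = monomial c 1}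

/-- The degree `b` component of `k[v](-a₁) ⊕ ⋯ ⊕ k[v](-a_r)`. -/
def freePiece (k : Type*) [Field k] {m r : ℕ} (deg : Fin r → Fin m →₀ ℕ) (b : Fin m →₀ ℕ) :
    Set (Fin r → MvPolynomial (Fin m) k) :=
  {x | ∀ j, x j ∈ shiftedPiece k (deg j) b}

/-- The degree `b` component of the face ring: the image of the degree `b` component of `k[v]`. -/
def faceRingPiece (k : Type*) [Field k] {m : ℕ} (K : Set (Finset (Fin m))) (b : Fin m →₀ ℕ) :
    Set (FaceRing k K) :=
  Ideal.Quotient.mk (stanleyReisnerIdeal k K) '' (shiftedPiece k 0 b)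

/-! ### Minimal free resolutions and Betti numbers -/

/-- An `ℕ^m`-graded minimal free resolution of length `h`
`0 ← k(K) ← F₀ ← F₁ ← ⋯ ← F_h ← 0` of the face ring, with `F_h ≠ 0`. Here
`F_i = k[v](-deg i 0) ⊕ ⋯ ⊕ k[v](-deg i (rank i - 1))` is a free graded module of finite rank,
and `F_i = 0` for `i > h`. Minimality says that every differential becomes zero after
tensoring with `k = k[v] / ⟨v_1, …, v_m⟩`. -/
structure MinimalFreeResolution (k : Type*) [Field k] {m : ℕ} (K : Set (Finset (Fin m)))
    (h : ℕ) where
  rank : ℕ → ℕ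
  deg : ∀ i, Fin (rank i) → Fin m →₀ ℕ
  aug : (Fin (rank 0) → MvPolynomial (Fin m) k) →ₗ[MvPolynomial (Fin m) k] FaceRing k K
  d : ∀ i, (Fin (rank (i + 1)) → MvPolynomial (Fin m) k) →ₗ[MvPolynomial (Fin m) k]
    (Fin (rank i) → MvPolynomial (Fin m) k)
  aug_graded : ∀ b, ∀ x ∈ freePiece k (deg 0) b, aug x ∈ faceRingPiece k K b
  d_graded : ∀ i b, ∀ x ∈ freePiece k (deg (i + 1)) b, d i x ∈ freePiece k (deg i) b
  aug_surjective : Function.Surjective aug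
  exact_aug : Function.Exact (d 0) aug
  exact_d : ∀ i, Function.Exact (d (i + 1)) (d i)
  minimal : ∀ i x j, d i x j ∈ Ideal.span (Set.range (X : Fin m → MvPolynomial (Fin m) k))
  rank_length : rank h ≠ 0
  rank_of_length_lt : ∀ i, h < i → rank i = 0

/-- The number of summands `k[v](-a)` in `F_i`, for `a` in `ℕ^m`. -/
def MinimalFreeResolution.multigradedBetti {k : Type*} [Field k] {m : ℕ}
    {K : Set (Finset (Fin m))} {h : ℕ} (F : MinimalFreeResolution k K h) (i : ℕ)
    (a : Fin m →₀ ℕ) : ℕ :=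
  Fintype.card {j : Fin (F.rank i) // F.deg i j = a}

/-- The Betti number `β_{i,a}` for a subset `a` of `[m]`. -/
def MinimalFreeResolution.betti {k : Type*} [Field k] {m : ℕ}
    {K : Set (Finset (Fin m))} {h : ℕ} (F : MinimalFreeResolution k K h) (i : ℕ)
    (a : Finset (Fin m)) : ℕ :=
  F.multigradedBetti i (squarefreeVec a)

end

/-! Fix a degree `b`. The degree `b` part of a graded free resolution is an exact sequence of
finite-dimensional vector spaces. `F_i` contributes one dimension for each generator of degree `≤
b`, and `k(K)` contributes 1 or 0 according to whether the support of `b` is a face. Counting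
dimensions modulo 2 makes signs irrelevant, so the total number of generators of degree `≤ b` is
congruent to that 1 or 0 (`sum_card_deg_le`). For `b` the indicator vector of a subset, the degrees
`≤ b` are exactly the indicator vectors of smaller subsets, so this reads `f = M(∑ β)`. Since `M` is
an involution modulo 2, `M(f) = ∑ β`.

Existence rests on the fact that the syzygies can be kept squarefree: the relations in degree `b`
depend only on the support of `b`. A syzygy module is thus encoded by a monotone family of subspaces
of one finite-dimensional space, indexed by subsets of `[m]`. Choosing in each subset a complement
to what comes from strictly smaller subsets gives minimal generators (`exists_minimal_generators`),
and their relations form a family of the same kind. Minimality makes the degrees of generators grow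
strictly at each step, so the process stops after at most `m` steps. -/

open MvPolynomial

/-! ### Homogeneous components of free modules, squarefree degrees and the Stanley–Reisner ideal -/

section Components

variable {k : Type*} [Field k] {m r s : ℕ}

/-- The vector of coefficients of the degree `b` component of an element of
`k[v](-deg 0) ⊕ ⋯ ⊕ k[v](-deg (r - 1))`. -/
noncomputable def degComp (deg : Fin r → Fin m →₀ ℕ) (b : Fin m →₀ ℕ) :
    (Fin r → MvPolynomial (Fin m) k) →ₗ[k] (Fin r → k) where
  -- Subtraction of exponents is truncated, so the guard is needed to discard generators whose
  -- degree is not below `b`.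
  toFun x l := if deg l ≤ b then coeff (b - deg l) (x l) else 0
  map_add' x y := by
    ext l
    by_cases h : deg l ≤ b <;> simp [h]
  map_smul' c x := by
    ext l
    by_cases h : deg l ≤ b <;> simp [h]

/-- The homogeneous element of degree `b` with given coefficients. -/
noncomputable def ofDegComp (deg : Fin r → Fin m →₀ ℕ) (b : Fin m →₀ ℕ) (w : Fin r → k) :
    Fin r → MvPolynomial (Fin m) k :=
  fun l => if deg l ≤ b then monomial (b - deg l) (w l) else 0

theorem degComp_apply (deg : Fin r → Fin m →₀ ℕ) (b : Fin m →₀ ℕ)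
    (x : Fin r → MvPolynomial (Fin m) k) (l : Fin r) :
    degComp deg b x l = if deg l ≤ b then coeff (b - deg l) (x l) else 0 := rfl

theorem degComp_apply_of_not_le {deg : Fin r → Fin m →₀ ℕ} {b : Fin m →₀ ℕ}
    (x : Fin r → MvPolynomial (Fin m) k) {l : Fin r} (h : ¬ deg l ≤ b) :
    degComp deg b x l = 0 := if_neg h

theorem degComp_add_deg (deg : Fin r → Fin m →₀ ℕ) (c : Fin m →₀ ℕ)
    (x : Fin r → MvPolynomial (Fin m) k) (l : Fin r) :
    degComp deg (c + deg l) x l = coeff c (x l) := by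
  rw [degComp_apply, if_pos (le_add_of_nonneg_left zero_le), add_tsub_cancel_right]

theorem ext_of_degComp {deg : Fin r → Fin m →₀ ℕ} {x y : Fin r → MvPolynomial (Fin m) k}
    (h : ∀ b, degComp deg b x = degComp deg b y) : x = y := by
  funext l
  ext c
  rw [← degComp_add_deg deg c x l, ← degComp_add_deg deg c y l, h]

theorem degComp_ofDegComp (deg : Fin r → Fin m →₀ ℕ) (b : Fin m →₀ ℕ) {w : Fin r → k}
    (hw : ∀ l, w l ≠ 0 → deg l ≤ b) : degComp deg b (ofDegComp deg b w) = w := by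
  funext l
  by_cases h : deg l ≤ b
  · simp [degComp_apply, ofDegComp, h]
  · rw [degComp_apply_of_not_le _ h]
    by_contra h'
    exact h (hw l (Ne.symm h'))

theorem degComp_ofDegComp_of_ne (deg : Fin r → Fin m →₀ ℕ) {b b' : Fin m →₀ ℕ} (hb : b' ≠ b)
    (w : Fin r → k) : degComp deg b' (ofDegComp deg b w) = 0 := by
  classical
  funext l
  by_cases h' : deg l ≤ b'
  · by_cases h : deg l ≤ b
    · simp only [degComp_apply, ofDegComp, h, h', if_true, coeff_monomial, Pi.zero_apply]
      refine if_neg fun e => hb ?_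
      rw [← tsub_add_cancel_of_le h', ← e, tsub_add_cancel_of_le h]
    · simp [degComp_apply, ofDegComp, h]
  · rw [degComp_apply_of_not_le _ h']
    rfl

theorem mem_shiftedPiece_iff {a b : Fin m →₀ ℕ} {p : MvPolynomial (Fin m) k} :
    p ∈ shiftedPiece k a b ↔ p = if a ≤ b then monomial (b - a) (coeff (b - a) p) else 0 := by
  classical
  by_cases h : a ≤ b
  · have hs : {p : MvPolynomial (Fin m) k | ∃ c : Fin m →₀ ℕ, a + c = b ∧ p = monomial c 1} =
        {monomial (b - a) 1} := by
      ext q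
      constructor
      · rintro ⟨c, rfl, rfl⟩
        simp
      · rintro rfl
        exact ⟨b - a, add_tsub_cancel_of_le h, rfl⟩
    rw [shiftedPiece, hs, Submodule.mem_span_singleton, if_pos h]
    constructor
    · rintro ⟨t, rfl⟩
      simp [smul_monomial]
    · intro hp
      exact ⟨coeff (b - a) p, by rw [smul_monomial, smul_eq_mul, mul_one]; exact hp.symm⟩
  · have hs : {p : MvPolynomial (Fin m) k | ∃ c : Fin m →₀ ℕ, a + c = b ∧ p = monomial c 1} =
        ∅ := by
      ext q
      simp only [Set.mem_ofPred_eq, Set.mem_empty_iff_false, iff_false]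
      rintro ⟨c, rfl, -⟩
      exact h (le_add_of_nonneg_right zero_le)
    rw [shiftedPiece, hs, Submodule.span_empty, Submodule.mem_bot, if_neg h]

theorem mem_freePiece_iff_ofDegComp {deg : Fin r → Fin m →₀ ℕ} {b : Fin m →₀ ℕ}
    {x : Fin r → MvPolynomial (Fin m) k} :
    x ∈ freePiece k deg b ↔ ofDegComp deg b (degComp deg b x) = x := by
  rw [funext_iff]
  refine forall_congr' fun l => ?_
  rw [mem_shiftedPiece_iff, eq_comm]
  by_cases h : deg l ≤ b <;> simp [ofDegComp, degComp_apply, h]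

theorem ofDegComp_mem_freePiece (deg : Fin r → Fin m →₀ ℕ) (b : Fin m →₀ ℕ) (w : Fin r → k) :
    ofDegComp deg b w ∈ freePiece k deg b := by
  rw [mem_freePiece_iff_ofDegComp]
  funext l
  by_cases h : deg l ≤ b <;> simp [ofDegComp, degComp_apply, h]

theorem mem_freePiece_iff {deg : Fin r → Fin m →₀ ℕ} {b : Fin m →₀ ℕ}
    {x : Fin r → MvPolynomial (Fin m) k} :
    x ∈ freePiece k deg b ↔ ∀ b' ≠ b, degComp deg b' x = 0 := by
  constructor
  · intro hx b' hb
    rw [mem_freePiece_iff_ofDegComp] at hx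
    rw [← hx, degComp_ofDegComp_of_ne deg hb]
  · intro hx
    rw [mem_freePiece_iff_ofDegComp]
    refine ext_of_degComp (deg := deg) fun b' => ?_
    by_cases hb : b' = b
    · subst hb
      refine degComp_ofDegComp deg b' fun l hl => ?_
      by_contra h
      exact hl (degComp_apply_of_not_le _ h)
    · rw [hx b' hb, degComp_ofDegComp_of_ne deg hb]

theorem degComp_ofDegComp_degComp {deg : Fin r → Fin m →₀ ℕ} (b : Fin m →₀ ℕ)
    (x : Fin r → MvPolynomial (Fin m) k) :
    degComp deg b (ofDegComp deg b (degComp deg b x)) = degComp deg b x := by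
  refine degComp_ofDegComp deg b fun l hl => ?_
  by_contra h
  exact hl (degComp_apply_of_not_le _ h)

/-- Only the monomial of exponent `b - a` in `p` carries a homogeneous element of degree `a` into
degree `b`. -/
theorem degComp_smul_of_mem_freePiece {deg : Fin r → Fin m →₀ ℕ} {a : Fin m →₀ ℕ}
    {u : Fin r → MvPolynomial (Fin m) k} (hu : u ∈ freePiece k deg a) (b : Fin m →₀ ℕ)
    (p : MvPolynomial (Fin m) k) :
    degComp deg b (p • u) = (if a ≤ b then coeff (b - a) p else 0) • degComp deg a u := by
  classical
  funext l
  have hul := hu l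
  rw [mem_shiftedPiece_iff] at hul
  simp only [Pi.smul_apply, smul_eq_mul, degComp_apply]
  by_cases hla : deg l ≤ a
  · rw [if_pos hla] at hul ⊢
    rw [hul]
    by_cases hlb : deg l ≤ b
    · simp only [if_pos hlb, coeff_mul_monomial', tsub_le_tsub_iff_right hlb]
      by_cases hab : a ≤ b
      · simp only [if_pos hab, coeff_monomial, if_true]
        rw [tsub_tsub_tsub_cancel_right hla]
      · simp [hab]
    · rw [if_neg hlb, if_neg fun hab => hlb (hla.trans hab), zero_mul]
  · rw [if_neg hla] at hul ⊢
    simp [hul]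

/-- A graded map is governed by one scalar matrix, the same in every degree. Passing to degree `b`
merely keeps the source generators of degree `≤ b`. -/
theorem degComp_map {deg' : Fin s → Fin m →₀ ℕ} {deg : Fin r → Fin m →₀ ℕ}
    (φ : (Fin s → MvPolynomial (Fin m) k) →ₗ[MvPolynomial (Fin m) k]
      (Fin r → MvPolynomial (Fin m) k))
    (hφ : ∀ j, φ (Pi.single j 1) ∈ freePiece k deg (deg' j)) (b : Fin m →₀ ℕ)
    (x : Fin s → MvPolynomial (Fin m) k) :
    degComp deg b (φ x) = ∑ j, degComp deg' b x j • degComp deg (deg' j) (φ (Pi.single j 1)) := by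
  conv_lhs => rw [pi_eq_sum_univ' x, map_sum, map_sum]
  refine Finset.sum_congr rfl fun j _ => ?_
  rw [map_smul]
  rw [degComp_smul_of_mem_freePiece (hφ j), degComp_apply]

theorem single_mem_freePiece (deg : Fin r → Fin m →₀ ℕ) (j : Fin r) :
    (Pi.single j 1 : Fin r → MvPolynomial (Fin m) k) ∈ freePiece k deg (deg j) := by
  classical
  intro l
  rw [mem_shiftedPiece_iff]
  by_cases h : l = j
  · subst h
    simp
  · simp [Pi.single_eq_of_ne h]

theorem squarefreeVec_apply (a : Finset (Fin m)) (i : Fin m) :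
    squarefreeVec a i = if i ∈ a then 1 else 0 := by
  classical
  simp [squarefreeVec, Finsupp.finsetSum_apply, Finsupp.single_apply]

theorem squarefreeVec_le_iff {a : Finset (Fin m)} {b : Fin m →₀ ℕ} :
    squarefreeVec a ≤ b ↔ a ⊆ b.support := by
  rw [Finsupp.le_def]
  refine forall_congr' fun i => ?_
  rw [squarefreeVec_apply, Finsupp.mem_support_iff]
  by_cases h : i ∈ a <;> simp [h, Nat.one_le_iff_ne_zero]

theorem support_squarefreeVec (a : Finset (Fin m)) : (squarefreeVec a).support = a := by
  ext i
  simp [squarefreeVec_apply]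

theorem squarefreeVec_injective :
    Function.Injective (squarefreeVec : Finset (Fin m) → Fin m →₀ ℕ) := fun a b h => by
  rw [← support_squarefreeVec a, h, support_squarefreeVec]

/-- This keeps Betti numbers in non-squarefree degrees out of the count in a squarefree degree. -/
theorem le_squarefreeVec_iff {a : Finset (Fin m)} {b : Fin m →₀ ℕ} :
    b ≤ squarefreeVec a ↔ ∃ c ⊆ a, b = squarefreeVec c := by
  constructor
  · intro h
    rw [Finsupp.le_def] at h
    refine ⟨b.support, fun i hi => ?_, ?_⟩
    · have := h i
      rw [squarefreeVec_apply] at this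
      by_contra hia
      rw [if_neg hia] at this
      exact Finsupp.mem_support_iff.1 hi (Nat.le_zero.1 this)
    · ext i
      have := h i
      rw [squarefreeVec_apply] at this ⊢
      simp only [Finsupp.mem_support_iff]
      split_ifs at this ⊢ <;> omega
  · rintro ⟨c, hc, rfl⟩
    rwa [squarefreeVec_le_iff, support_squarefreeVec]

/-- The ideal is monomial, and by closure under subsets a monomial lies in it exactly when its
support is a non-face. -/
theorem mem_stanleyReisnerIdeal_iff {K : Set (Finset (Fin m))}
    (hK : ∀ a ∈ K, ∀ b ⊆ a, b ∈ K) {p : MvPolynomial (Fin m) k} :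
    p ∈ stanleyReisnerIdeal k K ↔ ∀ b, b.support ∈ K → coeff b p = 0 := by
  have hset : {p : MvPolynomial (Fin m) k | ∃ τ : Finset (Fin m), τ ∉ K ∧ p = ∏ i ∈ τ, X i} =
      (fun s => monomial s (1 : k)) '' (squarefreeVec '' Kᶜ) := by
    ext q
    simp only [Set.mem_ofPred_eq, Set.image_image, Set.mem_image, Set.mem_compl_iff]
    refine exists_congr fun τ => and_congr_right fun _ => ?_
    rw [squarefreeVec, monomial_sum_one, eq_comm]
    rfl
  rw [stanleyReisnerIdeal, hset, mem_ideal_span_monomial_image]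
  constructor
  · intro h b hb
    by_contra hc
    obtain ⟨_, ⟨τ, hτ, rfl⟩, hle⟩ := h b (mem_support_iff.2 hc)
    exact hτ (hK _ hb _ (squarefreeVec_le_iff.1 hle))
  · intro h b hb
    refine ⟨squarefreeVec b.support, ⟨_, fun hbK => ?_, rfl⟩, squarefreeVec_le_iff.2 subset_rfl⟩
    exact mem_support_iff.1 hb (h b hbK)

end Components

/-! ### Euler characteristic of a resolution in one degree, and Möbius inversion -/

section EulerCharacteristic

variable {k : Type*} [Field k] {m r : ℕ}

/-- The degree `b` component of a graded free module, as a subspace. -/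
noncomputable def freePieceSubmodule (k : Type*) [Field k] (deg : Fin r → Fin m →₀ ℕ)
    (b : Fin m →₀ ℕ) : Submodule k (Fin r → MvPolynomial (Fin m) k) :=
  Submodule.pi Set.univ fun l => shiftedPiece k (deg l) b

theorem mem_freePieceSubmodule {deg : Fin r → Fin m →₀ ℕ} {b : Fin m →₀ ℕ}
    {x : Fin r → MvPolynomial (Fin m) k} :
    x ∈ freePieceSubmodule k deg b ↔ x ∈ freePiece k deg b := by
  simp [freePieceSubmodule, freePiece, Submodule.mem_pi]

/-- The coordinates of a homogeneous element of degree `b`. -/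
noncomputable def freePieceEquiv (k : Type*) [Field k] (deg : Fin r → Fin m →₀ ℕ)
    (b : Fin m →₀ ℕ) : freePieceSubmodule k deg b ≃ₗ[k] ({j // deg j ≤ b} → k) :=
  LinearEquiv.ofBijective
    ((LinearMap.funLeft k k Subtype.val).comp
      ((degComp deg b).comp (freePieceSubmodule k deg b).subtype)) <| by
    classical
    constructor
    · intro x y hxy
      have hc : degComp deg b x.1 = degComp deg b y.1 := by
        funext l
        by_cases h : deg l ≤ b
        · exact congrFun hxy ⟨l, h⟩
        · rw [degComp_apply_of_not_le _ h, degComp_apply_of_not_le _ h]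
      refine Subtype.ext ?_
      rw [← mem_freePiece_iff_ofDegComp.1 (mem_freePieceSubmodule.1 x.2), hc,
        mem_freePiece_iff_ofDegComp.1 (mem_freePieceSubmodule.1 y.2)]
    · intro v
      refine ⟨⟨ofDegComp deg b fun l => if h : deg l ≤ b then v ⟨l, h⟩ else 0,
        mem_freePieceSubmodule.2 (ofDegComp_mem_freePiece _ _ _)⟩, ?_⟩
      funext l
      simp only [LinearMap.comp_apply, Submodule.subtype_apply, LinearMap.funLeft_apply]
      rw [degComp_ofDegComp]
      · rw [dif_pos l.2]
      · intro l hl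
        by_contra h
        exact hl (dif_neg h)

theorem finrank_freePieceSubmodule (deg : Fin r → Fin m →₀ ℕ) (b : Fin m →₀ ℕ) :
    Module.finrank k (freePieceSubmodule k deg b) = Fintype.card {j // deg j ≤ b} := by
  rw [(freePieceEquiv k deg b).finrank_eq, Module.finrank_fintype_fun_eq_card]

instance (deg : Fin r → Fin m →₀ ℕ) (b : Fin m →₀ ℕ) :
    FiniteDimensional k (freePieceSubmodule k deg b) :=
  Module.Finite.equiv (freePieceEquiv k deg b).symm

open Classical in
/-- The coefficient of `v^b` in an element of the face ring, for `b` supported on a face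
(and zero otherwise). -/
noncomputable def faceCoeff (k : Type*) [Field k] {K : Set (Finset (Fin m))}
    (hK : ∀ a ∈ K, ∀ b ⊆ a, b ∈ K) (b : Fin m →₀ ℕ) : FaceRing k K →ₗ[k] k :=
  if hb : b.support ∈ K then
    (((stanleyReisnerIdeal k K).restrictScalars k).liftQ (lcoeff k b)
      fun _ hp => LinearMap.mem_ker.2 ((mem_stanleyReisnerIdeal_iff hK).1 hp b hb)).comp
      (Submodule.Quotient.restrictScalarsEquiv k (stanleyReisnerIdeal k K)).symm.toLinearMap
  else 0

theorem faceCoeff_mk {K : Set (Finset (Fin m))} (hK : ∀ a ∈ K, ∀ b ⊆ a, b ∈ K)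
    {b : Fin m →₀ ℕ} (hb : b.support ∈ K) (p : MvPolynomial (Fin m) k) :
    faceCoeff k hK b (Ideal.Quotient.mk _ p) = coeff b p := by
  rw [faceCoeff, dif_pos hb]
  rfl

theorem faceCoeff_of_notMem {K : Set (Finset (Fin m))} (hK : ∀ a ∈ K, ∀ b ⊆ a, b ∈ K)
    {b : Fin m →₀ ℕ} (hb : b.support ∉ K) : faceCoeff k hK b = 0 := dif_neg hb

theorem mem_faceRingPiece {K : Set (Finset (Fin m))} {b : Fin m →₀ ℕ} {y : FaceRing k K}
    (hy : y ∈ faceRingPiece k K b) : ∃ t : k, y = Ideal.Quotient.mk _ (monomial b t) := by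
  obtain ⟨p, hp, rfl⟩ := hy
  have hp := mem_shiftedPiece_iff.1 hp
  rw [if_pos zero_le, tsub_zero] at hp
  exact ⟨coeff b p, by rw [← hp]⟩

/-- Each graded piece of the face ring is spanned by the class of one monomial, which vanishes when
the support is a non-face. -/
theorem eq_zero_of_faceCoeff_eq_zero {K : Set (Finset (Fin m))}
    (hK : ∀ a ∈ K, ∀ b ⊆ a, b ∈ K) {b : Fin m →₀ ℕ} {y : FaceRing k K}
    (hy : y ∈ faceRingPiece k K b) (h : faceCoeff k hK b y = 0) : y = 0 := by
  classical
  obtain ⟨t, rfl⟩ := mem_faceRingPiece hy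
  by_cases hb : b.support ∈ K
  · rw [faceCoeff_mk hK hb, coeff_monomial, if_pos rfl] at h
    rw [h, monomial_zero, map_zero]
  · rw [Ideal.Quotient.eq_zero_iff_mem, mem_stanleyReisnerIdeal_iff hK]
    intro b' hb'
    rw [coeff_monomial, if_neg]
    rintro rfl
    exact hb hb'

namespace MinimalFreeResolution

variable {K : Set (Finset (Fin m))} {h : ℕ} (F : MinimalFreeResolution k K h)

theorem degComp_d (i : ℕ) (b : Fin m →₀ ℕ)
    (x : Fin (F.rank (i + 1)) → MvPolynomial (Fin m) k) :
    degComp (F.deg i) b (F.d i x) = ∑ j, degComp (F.deg (i + 1)) b x j •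
      degComp (F.deg i) (F.deg (i + 1) j) (F.d i (Pi.single j 1)) :=
  degComp_map (F.d i) (fun j => F.d_graded i _ _ (single_mem_freePiece _ j)) b x

/-- The augmentation sends each basis vector to a scalar multiple of a monomial class in its own
degree, so degree `b` of the output sees only degree `b` of the input. This allows preimages to be
replaced by homogeneous ones. -/
theorem faceCoeff_aug (hK : ∀ a ∈ K, ∀ b ⊆ a, b ∈ K) {b : Fin m →₀ ℕ}
    {x y : Fin (F.rank 0) → MvPolynomial (Fin m) k}
    (hxy : degComp (F.deg 0) b x = degComp (F.deg 0) b y) :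
    faceCoeff k hK b (F.aug x) = faceCoeff k hK b (F.aug y) := by
  by_cases hb : b.support ∈ K
  swap
  · rw [faceCoeff_of_notMem hK hb]
    rfl
  choose t ht using fun j => mem_faceRingPiece (F.aug_graded _ _ (single_mem_freePiece _ j))
  have key : ∀ x, faceCoeff k hK b (F.aug x) = ∑ j, degComp (F.deg 0) b x j * t j := by
    intro x
    conv_lhs => rw [← Finset.univ_sum_single x, map_sum, map_sum]
    refine Finset.sum_congr rfl fun j _ => ?_
    rw [show Pi.single j (x j) = x j • (Pi.single j 1 : Fin (F.rank 0) → MvPolynomial (Fin m) k) by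
      rw [← Pi.single_smul, smul_eq_mul, mul_one], map_smul, ht,
      show x j • (Ideal.Quotient.mk (stanleyReisnerIdeal k K)) (monomial (F.deg 0 j) (t j)) =
        Ideal.Quotient.mk _ (x j * monomial (F.deg 0 j) (t j)) from rfl,
      faceCoeff_mk hK hb, coeff_mul_monomial', degComp_apply]
    split_ifs <;> simp
  rw [key, key, hxy]

/-- The degree `b` component of the differential. -/
noncomputable def dPiece (b : Fin m →₀ ℕ) (i : ℕ) :
    freePieceSubmodule k (F.deg (i + 1)) b →ₗ[k] freePieceSubmodule k (F.deg i) b :=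
  ((F.d i).restrictScalars k).restrict fun x hx =>
    mem_freePieceSubmodule.2 (F.d_graded i b x (mem_freePieceSubmodule.1 hx))

/-- The degree `b` component of the augmentation, in coordinates. -/
noncomputable def augPiece (hK : ∀ a ∈ K, ∀ b ⊆ a, b ∈ K) (b : Fin m →₀ ℕ) :
    freePieceSubmodule k (F.deg 0) b →ₗ[k] k :=
  (faceCoeff k hK b).comp
    ((F.aug.restrictScalars k).comp (freePieceSubmodule k (F.deg 0) b).subtype)

/-- The differential commutes with projection to degree `b`, so the degree `b` component of any
preimage is again a preimage. Exactness thereby passes to each degree. -/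
theorem exists_homogeneous_preimage {b : Fin m →₀ ℕ} {i : ℕ}
    (x : freePieceSubmodule k (F.deg i) b) {y : Fin (F.rank (i + 1)) → MvPolynomial (Fin m) k}
    (hy : F.d i y = x) : x ∈ LinearMap.range (F.dPiece b i) := by
  refine ⟨⟨ofDegComp (F.deg (i + 1)) b (degComp (F.deg (i + 1)) b y),
    mem_freePieceSubmodule.2 (ofDegComp_mem_freePiece _ _ _)⟩, Subtype.ext ?_⟩
  change F.d i (ofDegComp _ b (degComp _ b y)) = x
  rw [← mem_freePiece_iff_ofDegComp.1 (F.d_graded i b _ (ofDegComp_mem_freePiece _ _ _)), degComp_d,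
    degComp_ofDegComp_degComp, ← degComp_d, hy,
    mem_freePiece_iff_ofDegComp.1 (mem_freePieceSubmodule.1 x.2)]

theorem ker_dPiece (b : Fin m →₀ ℕ) (i : ℕ) :
    LinearMap.ker (F.dPiece b i) = LinearMap.range (F.dPiece b (i + 1)) := by
  apply le_antisymm
  · intro x hx
    obtain ⟨y, hy⟩ := (F.exact_d i x.1).1 (congrArg Subtype.val (LinearMap.mem_ker.1 hx))
    exact F.exists_homogeneous_preimage x hy
  · rintro _ ⟨y, rfl⟩
    exact Subtype.ext ((F.exact_d i _).2 ⟨y.1, rfl⟩)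

theorem ker_augPiece (hK : ∀ a ∈ K, ∀ b ⊆ a, b ∈ K) (b : Fin m →₀ ℕ) :
    LinearMap.ker (F.augPiece hK b) = LinearMap.range (F.dPiece b 0) := by
  apply le_antisymm
  · intro x hx
    have h0 : F.aug x.1 = 0 := eq_zero_of_faceCoeff_eq_zero hK
      (F.aug_graded b _ (mem_freePieceSubmodule.1 x.2)) (LinearMap.mem_ker.1 hx)
    obtain ⟨y, hy⟩ := (F.exact_aug x.1).1 h0
    exact F.exists_homogeneous_preimage x hy
  · rintro _ ⟨y, rfl⟩
    rw [LinearMap.mem_ker]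
    change faceCoeff k hK b (F.aug (F.d 0 y.1)) = 0
    rw [(F.exact_aug _).2 ⟨y.1, rfl⟩, map_zero]

-- The target is the line `k`, so only non-vanishing matters. Over a face, a preimage of the
-- monomial `v^b` supplies it after projection to degree `b`.
open Classical in
theorem finrank_range_augPiece (hK : ∀ a ∈ K, ∀ b ⊆ a, b ∈ K) (b : Fin m →₀ ℕ) :
    Module.finrank k (LinearMap.range (F.augPiece hK b)) = if b.support ∈ K then 1 else 0 := by
  by_cases hb : b.support ∈ K
  · have hne : F.augPiece hK b ≠ 0 := by
      obtain ⟨x, hx⟩ := F.aug_surjective (Ideal.Quotient.mk _ (monomial b 1))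
      intro h0
      have h1 := LinearMap.congr_fun h0 ⟨ofDegComp (F.deg 0) b (degComp (F.deg 0) b x),
        mem_freePieceSubmodule.2 (ofDegComp_mem_freePiece _ _ _)⟩
      change faceCoeff k hK b (F.aug (ofDegComp (F.deg 0) b (degComp (F.deg 0) b x))) = 0 at h1
      rw [F.faceCoeff_aug hK (degComp_ofDegComp_degComp b x), hx, faceCoeff_mk hK hb, coeff_monomial,
        if_pos rfl] at h1
      exact one_ne_zero h1
    rw [if_pos hb, LinearMap.range_eq_top.2 (LinearMap.surjective hne), finrank_top,
      Module.finrank_self]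
  · have h0 : F.augPiece hK b = 0 := by
      rw [augPiece, faceCoeff_of_notMem hK hb, LinearMap.zero_comp]
    rw [if_neg hb, h0, LinearMap.range_zero, finrank_bot]

open Classical in
/-- The Euler characteristic, modulo two, of the degree `b` component of a resolution. -/
theorem sum_card_deg_le (hK : ∀ a ∈ K, ∀ b ⊆ a, b ∈ K) (b : Fin m →₀ ℕ) :
    ∑ i ∈ Finset.range (h + 1), (Fintype.card {j // F.deg i j ≤ b} : ZMod 2) =
      if b.support ∈ K then 1 else 0 := by
  let ρ : ℕ → ℕ := fun i => Module.finrank k (LinearMap.range (F.dPiece b i))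
  have hsucc : ∀ i, Fintype.card {j // F.deg (i + 1) j ≤ b} = ρ i + ρ (i + 1) := by
    intro i
    rw [← finrank_freePieceSubmodule (k := k), ← (F.dPiece b i).finrank_range_add_finrank_ker,
      F.ker_dPiece]
  have hzero : Fintype.card {j // F.deg 0 j ≤ b} = (if b.support ∈ K then 1 else 0) + ρ 0 := by
    rw [← finrank_freePieceSubmodule (k := k), ← (F.augPiece hK b).finrank_range_add_finrank_ker,
      F.ker_augPiece, F.finrank_range_augPiece]
  -- Each rank `ρ i` is counted in two consecutive terms, so modulo 2 the sum telescopes to its two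
  -- ends.
  have hsum : ∀ n, ∑ i ∈ Finset.range (n + 1), (Fintype.card {j // F.deg i j ≤ b} : ZMod 2) =
      (if b.support ∈ K then 1 else 0) + (ρ n : ZMod 2) := by
    intro n
    induction n with
    | zero =>
      rw [Finset.sum_range_one, hzero]
      push_cast
      rfl
    | succ n ih =>
      rw [Finset.sum_range_succ, ih, hsucc]
      push_cast
      rw [add_assoc, ← add_assoc (ρ n : ZMod 2), CharTwo.add_self_eq_zero, zero_add]
  -- The last differential starts from `F_{h+1} = 0`.
  have hρ : ρ h = 0 := by
    have hr := F.rank_of_length_lt (h + 1) (Nat.lt_succ_self h)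
    have hempty : IsEmpty {j // F.deg (h + 1) j ≤ b} := ⟨fun j => (hr ▸ j.1 : Fin 0).elim0⟩
    have := hsucc h
    rw [Fintype.card_eq_zero] at this
    omega
  rw [hsum, hρ, Nat.cast_zero, add_zero]

theorem card_deg_le_squarefreeVec (i : ℕ) (a : Finset (Fin m)) :
    Fintype.card {j // F.deg i j ≤ squarefreeVec a} = ∑ c ∈ a.powerset, F.betti i c := by
  classical
  simp only [betti, multigradedBetti, Fintype.card_subtype]
  rw [← Finset.card_biUnion]
  · congr 1
    ext j
    simp [le_squarefreeVec_iff]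
  · intro c _ c' _ hne
    refine Finset.disjoint_left.2 fun j hj hj' => hne (squarefreeVec_injective ?_)
    rw [← (Finset.mem_filter.1 hj).2, ← (Finset.mem_filter.1 hj').2]

end MinimalFreeResolution

/-- The Möbius transform over `ℤ/2` is an involution. -/
theorem moebiusTransform_moebiusTransform (g : Finset (Fin m) → ZMod 2) :
    moebiusTransform (moebiusTransform g) = g := by
  classical
  funext a
  simp only [moebiusTransform]
  have hswap : ∑ b ∈ a.powerset, ∑ c ∈ b.powerset, g c =
      ∑ c ∈ a.powerset, ∑ _b ∈ Finset.Icc c a, g c := by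
    refine Finset.sum_comm' fun b c => ?_
    simp only [Finset.mem_powerset, Finset.mem_Icc]
    exact ⟨fun h => ⟨⟨h.2, h.1⟩, h.2.trans h.1⟩, fun h => ⟨h.1.2, h.1.1⟩⟩
  -- The interval from `c` to `a` has `2 ^ (|a| - |c|)` elements, which is even unless `c = a`.
  rw [hswap, Finset.sum_eq_single_of_mem a (Finset.mem_powerset_self a)]
  · simp
  · intro c hc hne
    have hca := Finset.mem_powerset.1 hc
    rw [Finset.sum_const, Finset.card_Icc_finset hca, nsmul_eq_mul, Nat.cast_pow]
    have hlt := Finset.card_lt_card (lt_of_le_of_ne hca hne)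
    rw [show ((2 : ℕ) : ZMod 2) = 0 from rfl, zero_pow (by omega), zero_mul]

/-- The Euler characteristic in squarefree degrees exhibits `f` as the transform of the total Betti
numbers; applying the involution inverts this. -/
theorem moebiusTransform_eq_sum_betti {k : Type*} [Field k] (f : Finset (Fin m) → ZMod 2)
    (hK : ∀ a ∈ suppComplex f, ∀ b ⊆ a, b ∈ suppComplex f) {h : ℕ}
    (F : MinimalFreeResolution k (suppComplex f) h) (a : Finset (Fin m)) :
    moebiusTransform f a = ((∑ i ∈ Finset.range (h + 1), F.betti i a : ℕ) : ZMod 2) := by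
  classical
  have hf : f = moebiusTransform
      fun a => ((∑ i ∈ Finset.range (h + 1), F.betti i a : ℕ) : ZMod 2) := by
    funext b
    have hE := F.sum_card_deg_le hK (squarefreeVec b)
    simp only [F.card_deg_le_squarefreeVec, support_squarefreeVec] at hE
    have hfb : f b = if b ∈ suppComplex f then 1 else 0 := by
      by_cases hb : f b = 1
      · rw [if_pos (show b ∈ suppComplex f from hb), hb]
      · rw [if_neg (show b ∉ suppComplex f from hb)]
        generalize f b = z at hb
        revert z
        decide
    rw [hfb, moebiusTransform]
    push_cast
    rw [Finset.sum_comm]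
    convert hE.symm using 2
    push_cast
    rfl
  conv_lhs => rw [hf, moebiusTransform_moebiusTransform]

end EulerCharacteristic

/-! ### Minimal generators of a monotone family of subspaces -/

section Generators

/-- A monotone family of subspaces indexed by a finite power set has minimal generators: a relation
among generators of index `≤ a` involves no generator of index `a`. -/
theorem exists_minimal_generators {k V : Type*} [Field k] [AddCommGroup V] [Module k V]
    [FiniteDimensional k V] {m : ℕ} (W : Finset (Fin m) → Submodule k V) (hW : Monotone W) :
    ∃ (n : ℕ) (S : Fin n → Finset (Fin m)) (g : Fin n → V), (∀ j, g j ∈ W (S j)) ∧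
      (∀ a, ∀ w ∈ W a, ∃ c : Fin n → k, (∀ j, c j ≠ 0 → S j ⊆ a) ∧ ∑ j, c j • g j = w) ∧
      ∀ a, ∀ c : Fin n → k, (∀ j, c j ≠ 0 → S j ⊆ a) → ∑ j, c j • g j = 0 →
        ∀ j, S j = a → c j = 0 := by
  classical
  -- `L a` is the part of `W a` coming from strictly smaller indices. A complement `C a` of it
  -- inside `W a`, obtained from the modular law, has a basis that serves as the generators of index
  -- `a`.
  let L : Finset (Fin m) → Submodule k V := fun a => ⨆ b : {b // b < a}, W b
  have hL : ∀ a, L a ≤ W a := fun a => iSup_le fun b => hW b.2.le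
  have hC : ∀ a, ∃ C : Submodule k V, Disjoint (L a) C ∧ L a ⊔ C = W a := by
    intro a
    obtain ⟨C, hC⟩ := exists_isCompl (L a)
    refine ⟨C ⊓ W a, hC.disjoint.mono_right inf_le_left, ?_⟩
    rw [← sup_inf_assoc_of_le _ (hL a), hC.sup_eq_top, top_inf_eq]
  choose C hdisj hsup using hC
  have hCW : ∀ a, C a ≤ W a := fun a => hsup a ▸ le_sup_right
  let ι := Σ a : Finset (Fin m), Fin (Module.finrank k (C a))
  let e : Fin (Fintype.card ι) ≃ ι := (Fintype.equivFin ι).symm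
  let g' : ι → V := fun i => (Module.finBasis k (C i.1) i.2 : V)
  have hg' : ∀ i : ι, g' i ∈ C i.1 := fun i => (Module.finBasis k (C i.1) i.2).2
  have hspan : ∀ a, W a ≤ Submodule.span k (g' '' {i | i.1 ⊆ a}) := by
    intro a
    induction a using Finset.strongInduction with
    | H a ih =>
      rw [← hsup a]
      refine sup_le (iSup_le fun b => (ih b.1 b.2).trans
        (Submodule.span_mono (Set.image_mono fun i (hi : i.1 ⊆ b.1) => hi.trans b.2.1))) ?_
      intro w hw
      have h := (Module.finBasis k (C a)).sum_repr ⟨w, hw⟩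
      rw [← Subtype.coe_inj] at h
      simp only [Submodule.coe_sum, Submodule.coe_smul] at h
      rw [← h]
      exact Submodule.sum_mem _ fun j _ => Submodule.smul_mem _ _
        (Submodule.subset_span ⟨⟨a, j⟩, Finset.Subset.refl a, rfl⟩)
  refine ⟨Fintype.card ι, fun j => (e j).1, fun j => g' (e j), fun j => hCW _ (hg' _), ?_, ?_⟩
  · intro a w hw
    obtain ⟨c, hc, rfl⟩ := (Finsupp.mem_span_image_iff_linearCombination k).1 (hspan a hw)
    refine ⟨fun j => c (e j), fun j hj => hc (Finsupp.mem_support_iff.2 hj), ?_⟩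
    rw [Finsupp.linearCombination_apply, Finsupp.sum_fintype _ _ (by simp)]
    exact e.sum_comp fun i => c i • g' i
  · intro a c hc h0
    have h1 : ∑ i : ι, c (e.symm i) • g' i = 0 := by
      rw [← h0, ← e.sum_comp]
      simp
    -- Split off the terms of index `a`: they lie in `C a`, the others in `L a`. Disjointness kills
    -- the first sum, and the basis property kills its coefficients.
    rw [Fintype.sum_sigma, ← Finset.add_sum_erase _ _ (Finset.mem_univ a)] at h1
    have hmemL : ∑ b ∈ Finset.univ.erase a, ∑ i : Fin (Module.finrank k (C b)),
        c (e.symm ⟨b, i⟩) • g' ⟨b, i⟩ ∈ L a := by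
      refine Submodule.sum_mem _ fun b hb => Submodule.sum_mem _ fun i _ => ?_
      by_cases hz : c (e.symm ⟨b, i⟩) = 0
      · rw [hz, zero_smul]
        exact Submodule.zero_mem _
      · have hba : b ⊆ a := by simpa using hc _ hz
        have hlt : b < a := lt_of_le_of_ne hba (Finset.ne_of_mem_erase hb)
        exact Submodule.smul_mem _ _
          (le_iSup (fun b : {b // b < a} => W b) ⟨b, hlt⟩ (hCW _ (hg' ⟨b, i⟩)))
    have hmemC : ∑ i : Fin (Module.finrank k (C a)), c (e.symm ⟨a, i⟩) • g' ⟨a, i⟩ ∈ C a :=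
      Submodule.sum_mem _ fun i _ => Submodule.smul_mem _ _ (hg' ⟨a, i⟩)
    have hzero : ∑ i : Fin (Module.finrank k (C a)), c (e.symm ⟨a, i⟩) • g' ⟨a, i⟩ = 0 := by
      refine Submodule.disjoint_def.1 (hdisj a) _ ?_ hmemC
      rw [eq_neg_of_add_eq_zero_left h1]
      exact Submodule.neg_mem _ hmemL
    have hzero' : ∑ i : Fin (Module.finrank k (C a)),
        c (e.symm ⟨a, i⟩) • Module.finBasis k (C a) i = 0 := by
      rw [← Subtype.coe_inj]
      simpa only [Submodule.coe_sum, Submodule.coe_smul, Submodule.coe_zero] using hzero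
    have hall := Fintype.linearIndependent_iff.1 (Module.finBasis k (C a)).linearIndependent _ hzero'
    rintro j rfl
    simpa using hall (e j).2

end Generators

/-! ### Iterated squarefree syzygies and their termination -/

section Syzygies

/-- A squarefree family of relations on free generators placed in degrees `index l ⊆ [m]`:
the relations in degree `a` are the vectors in `relations a`, and they involve only generators of
degree strictly less than `a`. -/
structure SyzygyFamily (k : Type*) [Field k] (m : ℕ) where
  rank : ℕ
  index : Fin rank → Finset (Fin m)
  relations : Finset (Fin m) → Submodule k (Fin rank → k)
  relations_mono : Monotone relations
  index_ssubset : ∀ a, ∀ w ∈ relations a, ∀ l, w l ≠ 0 → index l ⊂ a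

namespace SyzygyFamily

variable {k : Type*} [Field k] {m : ℕ}

/-- `T`, with generators mapped to the vectors `g`, is a minimal presentation of the relations
of `N`. -/
structure IsNext (N T : SyzygyFamily k m) (g : Fin T.rank → Fin N.rank → k) : Prop where
  mem : ∀ j, g j ∈ N.relations (T.index j)
  generates : ∀ a, ∀ w ∈ N.relations a,
    ∃ c : Fin T.rank → k, (∀ j, c j ≠ 0 → T.index j ⊆ a) ∧ ∑ j, c j • g j = w
  mem_relations_iff : ∀ a c, c ∈ T.relations a ↔
    (∀ j, c j ≠ 0 → T.index j ⊆ a) ∧ ∑ j, c j • g j = 0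

/-- Minimality of the generators says precisely that a relation of degree `a` avoids generators of
index `a`. This is the strict inclusion required of a family, so the construction can be repeated.
-/
theorem exists_isNext (N : SyzygyFamily k m) :
    ∃ (T : SyzygyFamily k m) (g : Fin T.rank → Fin N.rank → k), IsNext N T g := by
  obtain ⟨n, S, g, hmem, hgen, hmin⟩ := exists_minimal_generators N.relations N.relations_mono
  refine ⟨⟨n, S, fun a => ⟨⟨⟨{c | (∀ j, c j ≠ 0 → S j ⊆ a) ∧ ∑ j, c j • g j = 0}, ?_⟩, ?_⟩, ?_⟩,
    ?_, ?_⟩, g, hmem, hgen, fun a c => Iff.rfl⟩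
  · rintro c c' ⟨hc, hc0⟩ ⟨hc', hc0'⟩
    refine ⟨fun j hj => ?_, ?_⟩
    · by_cases h : c j = 0
      · refine hc' j fun h' => hj ?_
        simp [h, h']
      · exact hc j h
    · simp [add_smul, Finset.sum_add_distrib, hc0, hc0']
  · exact ⟨fun j hj => absurd rfl hj, by simp⟩
  · rintro t c ⟨hc, hc0⟩
    refine ⟨fun j hj => hc j fun h => hj (by simp [h]), ?_⟩
    simp [mul_smul, ← Finset.smul_sum, hc0]
  · rintro a b hab c ⟨hc, hc0⟩
    exact ⟨fun j hj => (hc j hj).trans hab, hc0⟩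
  · rintro a c ⟨hc, hc0⟩ j hj
    exact lt_of_le_of_ne (hc j hj) fun h => hj (hmin a c hc hc0 j h)

/-- A minimal presentation of the relations of `N`. -/
noncomputable def next (N : SyzygyFamily k m) : SyzygyFamily k m := N.exists_isNext.choose

/-- The minimal generators of the relations of `N`. -/
noncomputable def gens (N : SyzygyFamily k m) : Fin N.next.rank → Fin N.rank → k :=
  N.exists_isNext.choose_spec.choose

theorem isNext_next (N : SyzygyFamily k m) : IsNext N N.next N.gens :=
  N.exists_isNext.choose_spec.choose_spec

/-- A zero generator would make its own basis vector a relation in its own degree, against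
strictness. -/
theorem gens_ne_zero (N : SyzygyFamily k m) (j : Fin N.next.rank) : N.gens j ≠ 0 := by
  classical
  intro h
  have hmem : (Pi.single j 1 : Fin N.next.rank → k) ∈ N.next.relations (N.next.index j) := by
    rw [N.isNext_next.mem_relations_iff]
    refine ⟨fun i hi => ?_, ?_⟩
    · by_cases hij : i = j
      · rw [hij]
      · exact absurd (Pi.single_eq_of_ne hij _) hi
    · simp [Pi.single_apply, h]
  exact (N.next.index_ssubset _ _ hmem j (by simp)).ne rfl

/-- A nonzero coordinate of a generator points to an index strictly inside its own, so cardinalities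
rise at every step. Bounded by `m`, they force termination. -/
theorem le_card_index_next (N : SyzygyFamily k m) {n : ℕ} (hn : ∀ l, n ≤ (N.index l).card)
    (j : Fin N.next.rank) : n + 1 ≤ (N.next.index j).card := by
  obtain ⟨l, hl⟩ := Function.ne_iff.1 (N.gens_ne_zero j)
  exact (Nat.succ_le_succ (hn l)).trans
    (Finset.card_lt_card (N.index_ssubset _ _ (N.isNext_next.mem j) l hl))

/-- The family of relations of the face ring as a cyclic module. -/
@[reducible] noncomputable def faceRing (k : Type*) [Field k] {m : ℕ} (K : Set (Finset (Fin m)))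
    (hK : ∀ a ∈ K, ∀ b ⊆ a, b ∈ K) (hempty : ∅ ∈ K) : SyzygyFamily k m where
  rank := 1
  index _ := ∅
  relations a :=
    { carrier := {w | a ∈ K → w = 0}
      add_mem' := fun hx hy ha => by rw [hx ha, hy ha, add_zero]
      zero_mem' := fun _ => rfl
      smul_mem' := fun t x hx ha => by rw [hx ha, smul_zero] }
  relations_mono a b hab w hw hb := hw (hK b hb a hab)
  index_ssubset a w hw l hl := by
    -- The only generator has index `∅`, so strictness could fail only at `a = ∅`, where there are
    -- no nonzero relations because `∅` is a face.
    rw [Finset.empty_ssubset, Finset.nonempty_iff_ne_empty]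
    rintro rfl
    exact hl (by rw [hw hempty]; rfl)

/-- The iterated minimal presentations of the relations of `N`. -/
noncomputable def iter (N : SyzygyFamily k m) : ℕ → SyzygyFamily k m
  | 0 => N
  | i + 1 => (iter N i).next

theorem le_card_index_iter (N : SyzygyFamily k m) (i : ℕ) :
    ∀ l, i ≤ ((N.iter i).index l).card := by
  induction i with
  | zero => exact fun _ => Nat.zero_le _
  | succ i ih => exact le_card_index_next _ ih

theorem rank_iter_eq_zero (N : SyzygyFamily k m) {i : ℕ} (hi : m < i) : (N.iter i).rank = 0 := by
  by_contra h
  have h1 := N.le_card_index_iter i ⟨0, Nat.pos_of_ne_zero h⟩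
  have h2 := Finset.card_le_univ ((N.iter i).index ⟨0, Nat.pos_of_ne_zero h⟩)
  rw [Fintype.card_fin] at h2
  omega

end SyzygyFamily

end Syzygies

/-! ### From squarefree syzygies to a minimal free resolution -/

section Existence

namespace SyzygyFamily

variable {k : Type*} [Field k] {m : ℕ}

/-- The degrees in `ℕ^m` of the generators. -/
noncomputable def deg (N : SyzygyFamily k m) (l : Fin N.rank) : Fin m →₀ ℕ :=
  squarefreeVec (N.index l)

theorem deg_le_iff (N : SyzygyFamily k m) {l : Fin N.rank} {b : Fin m →₀ ℕ} :
    N.deg l ≤ b ↔ N.index l ⊆ b.support := squarefreeVec_le_iff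

/-- The graded map of free modules with matrix `N.gens`. -/
noncomputable def differential (N : SyzygyFamily k m) :
    (Fin N.next.rank → MvPolynomial (Fin m) k) →ₗ[MvPolynomial (Fin m) k]
      (Fin N.rank → MvPolynomial (Fin m) k) :=
  Fintype.linearCombination (MvPolynomial (Fin m) k)
    fun j => ofDegComp N.deg (N.next.deg j) (N.gens j)

theorem differential_single (N : SyzygyFamily k m) (j : Fin N.next.rank) :
    N.differential (Pi.single j 1) = ofDegComp N.deg (N.next.deg j) (N.gens j) := by
  rw [differential, Fintype.linearCombination_apply_single, one_smul]

theorem degComp_differential (N : SyzygyFamily k m) (b : Fin m →₀ ℕ)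
    (x : Fin N.next.rank → MvPolynomial (Fin m) k) :
    degComp N.deg b (N.differential x) = ∑ j, degComp N.next.deg b x j • N.gens j := by
  rw [degComp_map (deg' := N.next.deg) N.differential
    fun j => by rw [differential_single]; exact ofDegComp_mem_freePiece _ _ _]
  refine Finset.sum_congr rfl fun j _ => ?_
  rw [differential_single, degComp_ofDegComp]
  intro l hl
  rw [deg_le_iff, deg, support_squarefreeVec]
  exact (N.index_ssubset _ _ (N.isNext_next.mem j) l hl).subset

theorem degComp_ne_zero (N : SyzygyFamily k m) {b : Fin m →₀ ℕ}
    {x : Fin N.rank → MvPolynomial (Fin m) k} {l : Fin N.rank} (h : degComp N.deg b x l ≠ 0) :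
    N.index l ⊆ b.support := by
  rw [← deg_le_iff]
  by_contra hl
  exact h (degComp_apply_of_not_le _ hl)

/-- Kernels are described by the same degreewise condition as images in
`mem_range_differential_iff`, so exactness is the comparison of the two. -/
theorem differential_eq_zero_iff (N : SyzygyFamily k m)
    (x : Fin N.next.rank → MvPolynomial (Fin m) k) :
    N.differential x = 0 ↔ ∀ b, degComp N.next.deg b x ∈ N.next.relations b.support := by
  constructor
  · intro h b
    rw [N.isNext_next.mem_relations_iff, ← degComp_differential, h, map_zero]
    exact ⟨fun j => N.next.degComp_ne_zero, rfl⟩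
  · intro h
    refine ext_of_degComp (deg := N.deg) fun b => ?_
    rw [degComp_differential, map_zero]
    exact ((N.isNext_next.mem_relations_iff _ _).1 (h b)).2

theorem mem_range_differential_iff (N : SyzygyFamily k m)
    (y : Fin N.rank → MvPolynomial (Fin m) k) :
    y ∈ Set.range N.differential ↔ ∀ b, degComp N.deg b y ∈ N.relations b.support := by
  classical
  constructor
  · rintro ⟨x, rfl⟩ b
    rw [degComp_differential]
    refine Submodule.sum_mem _ fun j _ => ?_
    by_cases h : degComp N.next.deg b x j = 0
    · rw [h, zero_smul]
      exact Submodule.zero_mem _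
    · exact Submodule.smul_mem _ _
        (N.relations_mono (N.next.degComp_ne_zero h) (N.isNext_next.mem j))
  · intro h
    choose z hz hzsum using fun b => N.isNext_next.generates _ _ (h b)
    -- A finite set containing every degree in which `y` has a nonzero component; the chosen lifts
    -- `z b` are summed only over it.
    let B : Finset (Fin m →₀ ℕ) :=
      Finset.univ.biUnion fun l => (y l).support.image fun c => c + N.deg l
    have hB : ∀ b ∉ B, degComp N.deg b y = 0 := by
      intro b hb
      funext l
      by_cases hl : N.deg l ≤ b
      · rw [degComp_apply, if_pos hl, Pi.zero_apply]
        by_contra hc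
        exact hb (Finset.mem_biUnion.2 ⟨l, Finset.mem_univ _, Finset.mem_image.2
          ⟨b - N.deg l, mem_support_iff.2 hc, tsub_add_cancel_of_le hl⟩⟩)
      · exact degComp_apply_of_not_le _ hl
    refine ⟨∑ b ∈ B, ofDegComp N.next.deg b (z b), ext_of_degComp (deg := N.deg) fun b => ?_⟩
    rw [degComp_differential, map_sum]
    by_cases hb : b ∈ B
    · rw [Finset.sum_eq_single_of_mem b hb fun b' _ hne => degComp_ofDegComp_of_ne _ hne.symm _,
        degComp_ofDegComp _ _ fun j hj => N.next.deg_le_iff.2 (hz b j hj), hzsum]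
    · rw [Finset.sum_eq_zero fun b' hb' => degComp_ofDegComp_of_ne _ (ne_of_mem_of_not_mem hb' hb).symm _,
        hB b hb]
      simp

theorem differential_mem_freePiece (N : SyzygyFamily k m) (b : Fin m →₀ ℕ)
    (x : Fin N.next.rank → MvPolynomial (Fin m) k) (hx : x ∈ freePiece k N.next.deg b) :
    N.differential x ∈ freePiece k N.deg b := by
  rw [mem_freePiece_iff] at hx ⊢
  intro b' hb
  rw [degComp_differential, hx b' hb]
  simp

/-- A constant term in coordinate `l` would be a nonzero entry at `l` of a relation of degree
`N.index l`, which strictness forbids. -/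
theorem differential_apply_mem (N : SyzygyFamily k m)
    (x : Fin N.next.rank → MvPolynomial (Fin m) k) (l : Fin N.rank) :
    N.differential x l ∈ Ideal.span (Set.range (X : Fin m → MvPolynomial (Fin m) k)) := by
  rw [← Set.image_univ, mem_ideal_span_X_image]
  intro c hc
  rw [mem_support_iff, ← degComp_add_deg N.deg c (N.differential x) l] at hc
  have hss := N.index_ssubset _ _ ((N.mem_range_differential_iff _).1 ⟨x, rfl⟩ _) l hc
  by_contra! h0
  have : c = 0 := Finsupp.ext fun i => h0 i (Set.mem_univ i)
  rw [this, zero_add, deg, support_squarefreeVec] at hss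
  exact hss.ne rfl

end SyzygyFamily

variable (k : Type*) [Field k] {m : ℕ} (K : Set (Finset (Fin m)))

/-- The projection `k[v] → k(K)`, as a map on the free module of rank one. -/
noncomputable def faceRingAug :
    (Fin 1 → MvPolynomial (Fin m) k) →ₗ[MvPolynomial (Fin m) k] FaceRing k K :=
  (Submodule.mkQ (stanleyReisnerIdeal k K)).comp (LinearMap.proj 0)

theorem faceRingAug_apply (x : Fin 1 → MvPolynomial (Fin m) k) :
    faceRingAug k K x = Ideal.Quotient.mk (stanleyReisnerIdeal k K) (x 0) := rfl

theorem deg_faceRing (hK : ∀ a ∈ K, ∀ b ⊆ a, b ∈ K) (hempty : ∅ ∈ K)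
    (l : Fin (SyzygyFamily.faceRing k K hK hempty).rank) :
    (SyzygyFamily.faceRing k K hK hempty).deg l = 0 := by
  show squarefreeVec ∅ = 0
  simp [squarefreeVec]

theorem faceRingAug_eq_zero_iff (hK : ∀ a ∈ K, ∀ b ⊆ a, b ∈ K) (hempty : ∅ ∈ K)
    (x : Fin (SyzygyFamily.faceRing k K hK hempty).rank → MvPolynomial (Fin m) k) :
    faceRingAug k K x = 0 ↔ ∀ b, degComp (SyzygyFamily.faceRing k K hK hempty).deg b x ∈
      (SyzygyFamily.faceRing k K hK hempty).relations b.support := by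
  rw [faceRingAug_apply, Ideal.Quotient.eq_zero_iff_mem, mem_stanleyReisnerIdeal_iff hK]
  refine forall_congr' fun b => ?_
  change _ ↔ (b.support ∈ K → _ = 0)
  refine imp_congr_right fun _ => ?_
  have h : ∀ l, degComp (SyzygyFamily.faceRing k K hK hempty).deg b x l = coeff b (x l) := by
    intro l
    rw [degComp_apply, deg_faceRing, if_pos zero_le, tsub_zero]
  constructor
  · intro h0
    funext l
    rw [h l, show l = (0 : Fin 1) from Subsingleton.elim (α := Fin 1) l 0]
    exact h0
  · intro h0
    exact (h (0 : Fin 1)).symm.trans (congrFun h0 (0 : Fin 1))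

theorem exists_minimalFreeResolution (hK : ∀ a ∈ K, ∀ b ⊆ a, b ∈ K) (hempty : ∅ ∈ K) :
    ∃ h : ℕ, Nonempty (MinimalFreeResolution k K h) := by
  classical
  let N := (SyzygyFamily.faceRing k K hK hempty).iter
  have h0 : (N 0).rank ≠ 0 := one_ne_zero
  -- The length is the last nonzero rank; searching up to `m` suffices because all ranks beyond `m`
  -- vanish.
  let h := Nat.findGreatest (fun i => (N i).rank ≠ 0) m
  refine ⟨h, ⟨{
    rank := fun i => (N i).rank
    deg := fun i => (N i).deg
    aug := faceRingAug k K
    d := fun i => (N i).differential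
    aug_graded := ?_
    d_graded := fun i => (N i).differential_mem_freePiece
    aug_surjective := ?_
    exact_aug := fun y => (faceRingAug_eq_zero_iff k K hK hempty y).trans
      ((N 0).mem_range_differential_iff y).symm
    exact_d := fun i y => ((N i).differential_eq_zero_iff y).trans
      ((N (i + 1)).mem_range_differential_iff y).symm
    minimal := fun i => (N i).differential_apply_mem
    rank_length := Nat.findGreatest_spec (P := fun i => (N i).rank ≠ 0) (Nat.zero_le m) h0
    rank_of_length_lt := ?_ }⟩⟩
  · intro b x hx
    have hx0 := hx (0 : Fin 1)
    rw [show (N 0).deg (0 : Fin 1) = 0 from deg_faceRing k K hK hempty (0 : Fin 1)] at hx0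
    exact ⟨_, hx0, rfl⟩
  · intro y
    obtain ⟨p, rfl⟩ := Ideal.Quotient.mk_surjective y
    exact ⟨fun _ => p, rfl⟩
  · intro i hi
    by_cases him : i ≤ m
    · exact not_not.1 (Nat.findGreatest_is_greatest hi him)
    · exact SyzygyFamily.rank_iter_eq_zero _ (not_le.1 him)

end Existence

theorem theorem1p1 (k : Type*) [Field k] (m : ℕ) (hm : 0 < m)
    (f : Finset (Fin m) → ZMod 2) (hf : IsSimplicialComplexOn (suppComplex f)) :
    (∃ h : ℕ, Nonempty (MinimalFreeResolution k (suppComplex f) h)) ∧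
    ∀ (h : ℕ) (F : MinimalFreeResolution k (suppComplex f) h),
      moebiusTransform f =
          ∑ i ∈ Finset.range (h + 1), ∑ a : Finset (Fin m), (F.betti i a : ZMod 2) • deltaFun a ∧
      ∀ a : Finset (Fin m),
        moebiusTransform f a = ((∑ i ∈ Finset.range (h + 1), F.betti i a : ℕ) : ZMod 2) := by
  refine ⟨?_, fun h F => ⟨?_, moebiusTransform_eq_sum_betti f hf.down_closed F⟩⟩
  -- Since `m > 0` there is a vertex, hence a face containing it, hence `∅` is a face.
  · obtain ⟨a, ha, -⟩ := hf.vertex_set ⟨0, hm⟩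
    exact exists_minimalFreeResolution k _ hf.down_closed
      (hf.down_closed a ha ∅ (Finset.empty_subset a))
  · funext b
    rw [moebiusTransform_eq_sum_betti f hf.down_closed F b]
    simp [Finset.sum_apply, deltaFun]
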